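/- Let $n>3$ and $0\le s<n$ be integers and let $a_1,\dots,a_n\in\mathbb{R}^s$ and $\nu>0$ be fixed. For each dimension $d>n$ let $P=P_d=\{x_1,\dots,x_n\}\subset\mathbb{R}^d$ be the original point cloud with $x_i=(a_i,0,\dots,0)^T$. Let $e_1,\dots,e_n$ be i.i.d. random vectors in $\mathbb{R}^d$ whose law is absolutely continuous with respect to Lebesgue measure and has mean zero and covariance matrix $\nu I_d$, the coordinates of each $e_i$ being i.i.d. as well. Let $P'=P'_d=\{x_1',\dots,x_n'\}$ with $x_i'=x_i+e_i$ be the observed point cloud. For a finite point cloud $X\subset\mathbb{R}^d$ let $\mathrm{D}_N(X)$ be the $N$-th persistence diagram of its Čech filtration, that is, of the complexes $\{\sigma\subseteq X:\bigcap_{x\in\sigma}B_x(r)\neq\emptyset\}$, where $B_x(r)\subset\mathbb{R}^d$ is the closed ball of radius $r$ and centre $x$, taken with reduced homology and coefficients in a field $\mathbb{F}$. Let $\bar{\mathrm{D}}_N(X)$ be the disjoint union of the multiset $\mathrm{D}_N(X)$ and of all points $(t,t)$, $t\ge 0$, of the diagonal, each with countably infinite multiplicity. Let $d_B(A,B)=\inf_\eta\sup_{p\in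 A}\|p-\eta(p)\|_\infty$, with $\eta$ ranging over all bijections $A\to B$, be the bottleneck distance. Then for every integer $0\le N\le n-2$ the distance $d_B\big(\bar{\mathrm{D}}_N(P),\bar{\mathrm{D}}_N(P')\big)$ is finite, and $$d_B\big(\bar{\mathrm{D}}_N(P),\bar{\mathrm{D}}_N(P')\big)=O_{\mathbb{P}}(\sqrt d)\qquad\text{as } d\to\infty,$$ that is, $d_B(\bar{\mathrm{D}}_N(P),\bar{\mathrm{D}}_N(P'))=\sqrt d\,Y_d$, where for every $\varepsilon>0$ there exist a constant $C$ and an integer $M$ with $\mathbb{P}(|Y_d|\le C)\ge 1-\varepsilon$ for all $d>M$. -/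

import Mathlib

open MeasureTheory ProbabilityTheory Filter
open scoped ENNReal

noncomputable section

/-! ### Reduced simplicial homology with field coefficients -/

section Homology

variable (F : Type*) [Field F] {V : Type*} [LinearOrder V]

/-- The `k`-dimensional simplices of `K`, each listed as the increasing tuple of its `k + 1`
vertices. -/
def simplices (K : PreAbstractSimplicialComplex V) (k : ℕ) : Set (Fin (k + 1) → V) :=
  {v | StrictMono v ∧ Finset.univ.image v ∈ K}

/-- The vector space with basis the `m`-tuples of vertices. -/
def TupleSpace (V : Type*) (m : ℕ) : Type _ := (Fin m → V) →₀ F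

instance (V : Type*) (m : ℕ) : AddCommGroup (TupleSpace F V m) :=
  inferInstanceAs (AddCommGroup ((Fin m → V) →₀ F))

instance (V : Type*) (m : ℕ) : Module F (TupleSpace F V m) :=
  inferInstanceAs (Module F ((Fin m → V) →₀ F))

/-- The simplicial chains `C_k(K; F)`: the span of the `k`-dimensional simplices of `K`. -/
def chains (K : PreAbstractSimplicialComplex V) (k : ℕ) : Submodule F (TupleSpace F V (k + 1)) :=
  Finsupp.supported F F (simplices K k)

/-- The simplicial boundary `∂ (v₀, …, v_k) = ∑ i, (-1)^i (v₀, …, v̂_i, …, v_k)`.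
For `k = 0` the only face is the empty tuple, so that `∂` is the augmentation. -/
def boundary (V : Type*) (k : ℕ) : TupleSpace F V (k + 1) →ₗ[F] TupleSpace F V k :=
  Finsupp.linearCombination F fun v : Fin (k + 1) → V =>
    ∑ i : Fin (k + 1), (-1 : F) ^ (i : ℕ) •
      (Finsupp.single (fun j => v (i.succAbove j)) 1 : (Fin k → V) →₀ F)

/-- The reduced cycles: in dimension `0` these are the chains with coefficient sum zero. -/
def cycles (K : PreAbstractSimplicialComplex V) (k : ℕ) : Submodule F (TupleSpace F V (k + 1)) :=
  chains F K k ⊓ LinearMap.ker (boundary F V k)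

/-- The boundaries of `(k + 1)`-chains. -/
def boundaries (K : PreAbstractSimplicialComplex V) (k : ℕ) :
    Submodule F (TupleSpace F V (k + 1)) :=
  (chains F K (k + 1)).map (boundary F V (k + 1))

/-- The `k`-th reduced homology of `K` with coefficients in `F`: cycles modulo boundaries. -/
abbrev redHomology (K : PreAbstractSimplicialComplex V) (k : ℕ) : Type _ :=
  cycles F K k ⧸ (boundaries F K k).comap (cycles F K k).subtype

variable {K L : PreAbstractSimplicialComplex V}

theorem chains_mono (h : K ≤ L) (k : ℕ) : chains F K k ≤ chains F L k :=
  Finsupp.supported_mono fun _ hv => ⟨hv.1, h hv.2⟩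

theorem cycles_mono (h : K ≤ L) (k : ℕ) : cycles F K k ≤ cycles F L k :=
  inf_le_inf_right _ (chains_mono F h k)

theorem boundaries_mono (h : K ≤ L) (k : ℕ) : boundaries F K k ≤ boundaries F L k :=
  Submodule.map_mono (chains_mono F h (k + 1))

/-- The linear map in homology induced by an inclusion `K ≤ L` of simplicial complexes. -/
def redHomologyMap (h : K ≤ L) (k : ℕ) : redHomology F K k →ₗ[F] redHomology F L k :=
  Submodule.mapQ _ _ (Submodule.inclusion (cycles_mono F h k))
    fun _ hz => boundaries_mono F h k hz

/-- The persistent Betti number: the rank of `H_k(K) → H_k(L)`. -/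
def persistentBetti (h : K ≤ L) (k : ℕ) : ℕ :=
  Module.finrank F (LinearMap.range (redHomologyMap F h k))

end Homology

/-! ### The Čech filtration and its persistence diagrams -/

section Cech

variable {E : Type*} [PseudoMetricSpace E] {n : ℕ}

/-- The (ambient) Čech complex of the point cloud `x₁, …, xₙ` at radius `r`: the vertices are
the (indices of the) points, and a set of points is a face if the closed balls of radius `r`
around them have a common point. -/
def cech (x : Fin n → E) (r : ℝ) : PreAbstractSimplicialComplex (Fin n) where
  faces := {σ | σ.Nonempty ∧ (⋂ i ∈ σ, Metric.closedBall (x i) r).Nonempty}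
  isRelLowerSet_faces := by
    rintro σ ⟨hσ, p, hp⟩
    refine ⟨hσ, fun τ hτ hne => ⟨hne, p, ?_⟩⟩
    simp only [Set.mem_iInter] at hp ⊢
    exact fun i hi => hp i (hτ hi)

/-- The Čech complex just before radius `r`, that is, the union of the complexes at all smaller
radii. At a critical radius this is the complex of the previous critical radius (the empty
complex if there is none), and at any other radius it equals `cech x r`. -/
def cechBefore (x : Fin n → E) (r : ℝ) : PreAbstractSimplicialComplex (Fin n) :=
  ⨆ s : Set.Iio r, cech x s

theorem cech_mono (x : Fin n → E) {r s : ℝ} (h : r ≤ s) : cech x r ≤ cech x s := by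
  rintro σ ⟨hσ, p, hp⟩
  refine ⟨hσ, p, ?_⟩
  simp only [Set.mem_iInter] at hp ⊢
  exact fun i hi => Metric.closedBall_subset_closedBall h (hp i hi)

theorem cechBefore_le (x : Fin n → E) (r : ℝ) : cechBefore x r ≤ cech x r :=
  iSup_le fun s => cech_mono x (le_of_lt s.2)

theorem cech_le_cechBefore (x : Fin n → E) {r s : ℝ} (h : r < s) : cech x r ≤ cechBefore x s :=
  le_iSup (fun t : Set.Iio s => cech x t) ⟨r, h⟩

/-- The `N`-th persistence diagram `D_N` of the Čech filtration of the point cloud `x`, a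
multiset of points of the plane given by its multiplicity function. For `b < d` the multiplicity
of `(b, d)` is the number of generators born at radius `b` that die at radius `d`:
(number alive at `b` that die at `d`) minus (number alive before `b` that die at `d`).
No subtraction truncates, since the ranks decrease along the filtration and the generators
counted second are among those counted first. -/
def cechDiagram (F : Type*) [Field F] (N : ℕ) (x : Fin n → E) (p : ℝ × ℝ) : ℕ :=
  if h : p.1 < p.2 then
    have h₁ : cech x p.1 ≤ cechBefore x p.2 := cech_le_cechBefore x h
    have h₂ : cech x p.1 ≤ cech x p.2 := cech_mono x h.le
    (persistentBetti F h₁ N - persistentBetti F h₂ N) -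
      (persistentBetti F ((cechBefore_le x p.1).trans h₁) N -
        persistentBetti F ((cechBefore_le x p.1).trans h₂) N)
  else 0

end Cech

/-- For a multiset `m` of points of the plane off the diagonal, the disjoint union of `m` and all
points `(t, t)`, `t ≥ 0`, of the diagonal with (countably) infinite multiplicity. The element
`(p, k)` is the `k`-th copy of the point `p`. -/
def withDiagonal (m : ℝ × ℝ → ℕ) : Set ((ℝ × ℝ) × ℕ) :=
  {q | q.2 < m q.1 ∨ (0 ≤ q.1.1 ∧ q.1.1 = q.1.2)}

/-- The bottleneck distance: the infimum over all bijections `η` of the supremum of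
`‖p - η p‖_∞` (the distance of `ℝ × ℝ` is the one of the sup norm). -/
def bottleneckDist (A B : Set ((ℝ × ℝ) × ℕ)) : ℝ≥0∞ :=
  ⨅ η : A ≃ B, ⨆ p : A, edist (p : (ℝ × ℝ) × ℕ).1 (η p : (ℝ × ℝ) × ℕ).1

/-! ### The point clouds -/

/-- The vector `(v₁, …, v_s, 0, …, 0)` of `ℝ^d` (it is used for `s ≤ d` only). -/
def zeroPad {s : ℕ} (d : ℕ) (v : Fin s → ℝ) : EuclideanSpace ℝ (Fin d) :=
  WithLp.toLp 2 fun k => if h : (k : ℕ) < s then v ⟨k, h⟩ else 0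

/-- The random vectors `e₁, …, eₙ` of `ℝ^d` form a noise point cloud of variance `ν`: they are
i.i.d. with an absolutely continuous law, mean zero and covariance matrix `ν • I`, and the
coordinates of each of them are i.i.d. -/
structure IsNoiseCloud {Ω : Type*} [MeasurableSpace Ω] (μ : Measure Ω) {n d : ℕ} (ν : ℝ)
    (e : Fin n → Ω → EuclideanSpace ℝ (Fin d)) : Prop where
  measurable : ∀ i, Measurable (e i)
  indep : iIndepFun e μ
  identDistrib : ∀ i j, IdentDistrib (e i) (e j) μ μ
  absolutelyContinuous : ∀ i, μ.map (e i) ≪ volume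
  memLp : ∀ i, MemLp (e i) 2 μ
  mean : ∀ i, ∫ ω, e i ω ∂μ = 0
  covariance : ∀ i k l, cov[fun ω => e i ω k, fun ω => e i ω l; μ] = if k = l then ν else 0
  indep_coord : ∀ i, iIndepFun (fun k ω => e i ω k) μ
  identDistrib_coord : ∀ i k l, IdentDistrib (fun ω => e i ω k) (fun ω => e i ω l) μ μ

/-! ### Boundedness in probability -/

section BigO

variable {Ω : ℕ → Type*} [∀ m, MeasurableSpace (Ω m)]

/-- `Y_m = O_ℙ(1)`: for every `ε > 0` there are `C` and `M` such that `|Y_m| ≤ C` with probability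
at least `1 - ε` for all `m > M`. (The complementary event is used, so that the
condition loses nothing in case of a non-measurable `Y_m`.) -/
def IsBoundedInProb (μ : ∀ m, Measure (Ω m)) (Y : ∀ m, Ω m → ℝ) : Prop :=
  ∀ ε : ℝ, 0 < ε → ∃ C : ℝ, ∃ M : ℕ, ∀ m, M < m →
    μ m {ω | ¬ |Y m ω| ≤ C} ≤ ENNReal.ofReal ε

/-- `X_m = O_ℙ(b_m)` as `m → ∞`: `X_m = b_m Y_m` (for all large `m`) for some `Y_m = O_ℙ(1)`. -/
def IsBigOInProb (μ : ∀ m, Measure (Ω m)) (X b : ∀ m, Ω m → ℝ) : Prop :=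
  ∃ Y : ∀ m, Ω m → ℝ, IsBoundedInProb μ Y ∧ ∀ᶠ m in atTop, ∀ ω, X m ω = b m ω * Y m ω

end BigO

end

/-! ### The support of the Čech diagram -/

section Support

/-! No stability theorem is needed, because the size of the clouds already gives the rate. If all
points of both clouds lie within `R` of a common centre, every off-diagonal diagram point lies in
`[0, R]²` (`cechDiagram_support`). Inside this square both diagrams, diagonal included, have the
cardinality of the continuum; any bijection there moves points by at most `R`, and the identity
serves outside (`bottleneckDist_le_of_support`). With the origin as centre, `R` has order `√d` once
`∑ i, ‖e i‖² ≤ K d`. The expectation of this sum is `n ν d`, so Markov's inequality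
(`IsNoiseCloud.measure_le_div`) makes failure unlikely for large `K`, uniformly in `d`. -/

theorem persistentBetti_congr_right (F : Type*) [Field F] {V : Type*} [LinearOrder V]
    {K L L' : PreAbstractSimplicialComplex V} (h : K ≤ L) (h' : K ≤ L') (hL : L = L') (k : ℕ) :
    persistentBetti F h k = persistentBetti F h' k := by
  subst hL; rfl

theorem persistentBetti_congr_left (F : Type*) [Field F] {V : Type*} [LinearOrder V]
    {K K' L : PreAbstractSimplicialComplex V} (h : K ≤ L) (h' : K' ≤ L) (hK : K = K') (k : ℕ) :
    persistentBetti F h k = persistentBetti F h' k := by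
  subst hK; rfl

theorem cech_le_of_neg {E : Type*} [PseudoMetricSpace E] {n : ℕ} (x : Fin n → E) {r : ℝ}
    (hr : r < 0) (K : PreAbstractSimplicialComplex (Fin n)) : cech x r ≤ K := by
  rintro σ ⟨⟨i, hi⟩, p, hp⟩
  simp only [Set.mem_iInter] at hp
  have := hp i hi
  rw [Metric.closedBall_eq_empty.2 hr] at this
  exact this.elim

theorem cech_le_of_dist_le {E : Type*} [PseudoMetricSpace E] {n : ℕ} {x : Fin n → E} {c : E}
    {R : ℝ} (hR : ∀ i, dist c (x i) ≤ R) (r : ℝ) : cech x r ≤ cech x R := by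
  rintro σ ⟨hσ, -⟩
  refine ⟨hσ, c, ?_⟩
  simp only [Set.mem_iInter]
  exact fun i _ => Metric.mem_closedBall.2 (hR i)

/-- No generator is born before radius `0`, and none dies after a radius at which all balls
have a common point. -/
theorem cechDiagram_support {E : Type*} [PseudoMetricSpace E] {n : ℕ} (F : Type*) [Field F]
    (N : ℕ) {x : Fin n → E} {c : E} {R : ℝ} (hR : ∀ i, dist c (x i) ≤ R) {p : ℝ × ℝ}
    (hp : cechDiagram F N x p ≠ 0) : p ∈ Set.Icc (0 : ℝ) R ×ˢ Set.Icc (0 : ℝ) R := by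
  unfold cechDiagram at hp
  split_ifs at hp with h
  · have h0 : 0 ≤ p.1 := by
      -- At a negative radius both complexes are empty, so the two terms of the outer difference
      -- coincide.
      by_contra! h0
      refine hp ?_
      have hK : cech x p.1 = cechBefore x p.1 :=
        le_antisymm (cech_le_of_neg x h0 _) (cechBefore_le x p.1)
      simp only
      rw [persistentBetti_congr_left F _ ((cechBefore_le x p.1).trans (cech_le_cechBefore x h)) hK,
        persistentBetti_congr_left F _ ((cechBefore_le x p.1).trans (cech_mono x h.le)) hK,
        Nat.sub_self]
    have h1 : p.2 ≤ R := by
      -- From radius `R` on the filtration is constant, so nothing dies at `p.2` and the first inner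
      -- difference is zero.
      by_contra! h1
      refine hp ?_
      have hL : cechBefore x p.2 = cech x p.2 :=
        le_antisymm (cechBefore_le x p.2)
          ((cech_le_of_dist_le hR p.2).trans (cech_le_cechBefore x h1))
      simp only
      rw [persistentBetti_congr_right F _ (cech_mono x h.le) hL, Nat.sub_self, Nat.zero_sub]
    exact ⟨⟨h0, h.le.trans h1⟩, ⟨h0.trans h.le, h1⟩⟩
  · exact (hp rfl).elim

end Support

/-! ### A bound for the bottleneck distance of diagrams with bounded support -/

section Bottleneck

/-- The diagonal segment alone supplies continuum many points, whatever `m` is; this requires `R >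
0`. -/
theorem mk_withDiagonal_inter_square (m : ℝ × ℝ → ℕ) {R : ℝ} (hR : 0 < R) :
    Cardinal.mk {a : withDiagonal m // a.1.1 ∈ Set.Icc (0 : ℝ) R ×ˢ Set.Icc (0 : ℝ) R} =
      Cardinal.continuum := by
  refine le_antisymm ?_ ?_
  · have h := Cardinal.mk_le_of_injective
      (f := fun a : {a : withDiagonal m // a.1.1 ∈ Set.Icc (0 : ℝ) R ×ˢ Set.Icc (0 : ℝ) R} =>
        (a.1.1 : (ℝ × ℝ) × ℕ))
      (fun a b hab => Subtype.ext (Subtype.ext hab))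
    refine h.trans (le_of_eq ?_)
    simp [Cardinal.mk_real]
  · rw [← Cardinal.mk_Icc_real hR]
    refine Cardinal.mk_le_of_injective
      (f := fun t : Set.Icc (0 : ℝ) R =>
        ⟨⟨((t.1, t.1), 0), Or.inr ⟨t.2.1, rfl⟩⟩, ⟨t.2, t.2⟩⟩) ?_
    intro s t hst
    have := congrArg (fun a => a.1.1.1.1) hst
    exact Subtype.ext this

/-- Outside of a square that contains all off-diagonal points, two diagrams agree. -/
def equivOutsideSquare {m m' : ℝ × ℝ → ℕ} {T : Set (ℝ × ℝ)} (hm : ∀ p, m p ≠ 0 → p ∈ T)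
    (hm' : ∀ p, m' p ≠ 0 → p ∈ T) :
    {a : withDiagonal m // ¬ a.1.1 ∈ T} ≃ {b : withDiagonal m' // ¬ b.1.1 ∈ T} where
  toFun a := ⟨⟨a.1.1, Or.inr (a.1.2.resolve_left fun h =>
    a.2 (hm _ (Nat.ne_zero_of_lt h)))⟩, a.2⟩
  invFun b := ⟨⟨b.1.1, Or.inr (b.1.2.resolve_left fun h =>
    b.2 (hm' _ (Nat.ne_zero_of_lt h)))⟩, b.2⟩
  left_inv _ := rfl
  right_inv _ := rfl

/-- Two diagrams whose off-diagonal points lie in `[0, R]²` have bottleneck distance at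
most `R`: the parts in the square, diagonal included, have the same cardinality. -/
theorem bottleneckDist_le_of_support {m m' : ℝ × ℝ → ℕ} {R : ℝ} (hR : 0 < R)
    (hm : ∀ p, m p ≠ 0 → p ∈ Set.Icc (0 : ℝ) R ×ˢ Set.Icc (0 : ℝ) R)
    (hm' : ∀ p, m' p ≠ 0 → p ∈ Set.Icc (0 : ℝ) R ×ˢ Set.Icc (0 : ℝ) R) :
    bottleneckDist (withDiagonal m) (withDiagonal m') ≤ ENNReal.ofReal R := by
  classical
  obtain ⟨e⟩ := Cardinal.eq.1
    ((mk_withDiagonal_inter_square m hR).trans (mk_withDiagonal_inter_square m' hR).symm)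
  refine iInf_le_of_le ((Equiv.sumCompl _).symm.trans
    ((Equiv.sumCongr e (equivOutsideSquare hm hm')).trans (Equiv.sumCompl _))) ?_
  refine iSup_le fun q => ?_
  obtain ⟨q | q, rfl⟩ := (Equiv.sumCompl fun a : withDiagonal m =>
    a.1.1 ∈ Set.Icc (0 : ℝ) R ×ˢ Set.Icc (0 : ℝ) R).surjective q
  · simp only [Equiv.trans_apply, Equiv.sumCongr_apply, Equiv.sumCompl_apply_inl]
    rw [edist_dist]
    refine ENNReal.ofReal_le_ofReal (max_le ?_ ?_)
    · simpa using Real.dist_le_of_mem_Icc q.2.1 (e q).2.1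
    · simpa using Real.dist_le_of_mem_Icc q.2.2 (e q).2.2
  · simp [equivOutsideSquare]

theorem bottleneckDist_cechDiagram_le {E : Type*} [PseudoMetricSpace E] {n : ℕ} (F : Type*)
    [Field F] (N : ℕ) {x y : Fin n → E} {c : E} {R : ℝ} (hR : 0 < R)
    (hx : ∀ i, dist c (x i) ≤ R) (hy : ∀ i, dist c (y i) ≤ R) :
    bottleneckDist (withDiagonal (cechDiagram F N x)) (withDiagonal (cechDiagram F N y)) ≤
      ENNReal.ofReal R :=
  bottleneckDist_le_of_support hR (fun _ => cechDiagram_support F N hx)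
    (fun _ => cechDiagram_support F N hy)

end Bottleneck

/-! ### Norms of the points and of the noise -/

section Noise

/-- Each of the `d` coordinates is at most the sum. The factor `√d` is wasteful but matches the
scale of the noise. -/
theorem norm_zeroPad_le {s : ℕ} (d : ℕ) (v : Fin s → ℝ) : ‖zeroPad d v‖ ≤ √d * ∑ j, |v j| := by
  have h0 : 0 ≤ ∑ j, |v j| := Finset.sum_nonneg fun _ _ => abs_nonneg _
  have hk : ∀ k, |zeroPad d v k| ≤ ∑ j, |v j| := by
    intro k
    by_cases h : (k : ℕ) < s
    · simpa [zeroPad, h] using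
        Finset.single_le_sum (f := fun j => |v j|) (fun _ _ => abs_nonneg _)
          (Finset.mem_univ (⟨k, h⟩ : Fin s))
    · simpa [zeroPad, h] using h0
  rw [EuclideanSpace.norm_eq, ← Real.sqrt_sq h0, ← Real.sqrt_mul (Nat.cast_nonneg d)]
  refine Real.sqrt_le_sqrt ?_
  calc ∑ k, ‖zeroPad d v k‖ ^ 2 ≤ ∑ _k : Fin d, (∑ j, |v j|) ^ 2 :=
        Finset.sum_le_sum fun k _ => pow_le_pow_left₀ (norm_nonneg _) (hk k) 2
    _ = d * (∑ j, |v j|) ^ 2 := by simp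

variable {Ω : Type*} [MeasurableSpace Ω] {μ : Measure Ω} {n d : ℕ}
  {ν : ℝ} {e : Fin n → Ω → EuclideanSpace ℝ (Fin d)}

theorem IsNoiseCloud.memLp_coord (he : IsNoiseCloud μ ν e) (i : Fin n) (k : Fin d) :
    MemLp (fun ω => e i ω k) 2 μ :=
  (EuclideanSpace.proj k : EuclideanSpace ℝ (Fin d) →L[ℝ] ℝ).comp_memLp' (he.memLp i)

theorem IsNoiseCloud.integral_coord_sq [IsProbabilityMeasure μ] (he : IsNoiseCloud μ ν e)
    (i : Fin n) (k : Fin d) :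
    ∫ ω, e i ω k ^ 2 ∂μ = ν := by
  have hmean : ∫ ω, e i ω k ∂μ = 0 := by
    have h := (EuclideanSpace.proj k : EuclideanSpace ℝ (Fin d) →L[ℝ] ℝ).integral_comp_comm
      ((he.memLp i).integrable one_le_two)
    rw [he.mean i, map_zero] at h
    exact h
  have hcov := (he.covariance i k k).trans (if_pos rfl)
  rw [ProbabilityTheory.covariance, hmean] at hcov
  simpa [sq] using hcov

theorem IsNoiseCloud.integrable_norm_sq (he : IsNoiseCloud μ ν e) (i : Fin n) :
    Integrable (fun ω => ‖e i ω‖ ^ 2) μ :=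
  (he.memLp i).integrable_norm_pow two_ne_zero

theorem IsNoiseCloud.integral_norm_sq [IsProbabilityMeasure μ] (he : IsNoiseCloud μ ν e)
    (i : Fin n) :
    ∫ ω, ‖e i ω‖ ^ 2 ∂μ = d * ν := by
  simp_rw [EuclideanSpace.norm_sq_eq, Real.norm_eq_abs, sq_abs]
  rw [integral_finsetSum _ fun k _ => (he.memLp_coord i k).integrable_sq]
  simp [he.integral_coord_sq i]

/-- Markov's inequality for the total squared norm of the noise. -/
theorem IsNoiseCloud.measure_le_div [IsProbabilityMeasure μ] (he : IsNoiseCloud μ ν e)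
    (hd : 0 < d) {K : ℝ} (hK : 0 < K) :
    μ {ω | K * d ≤ ∑ i, ‖e i ω‖ ^ 2} ≤ ENNReal.ofReal (n * ν / K) := by
  have hd' : (0 : ℝ) < d := Nat.cast_pos.2 hd
  have h := mul_meas_ge_le_integral_of_nonneg (μ := μ) (f := fun ω => ∑ i, ‖e i ω‖ ^ 2)
    (ae_of_all _ fun ω => Finset.sum_nonneg fun i _ => sq_nonneg _)
    (integrable_finsetSum _ fun i _ => he.integrable_norm_sq i) (K * d)
  rw [integral_finsetSum _ fun i _ => he.integrable_norm_sq i] at h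
  simp only [he.integral_norm_sq, Finset.sum_const, Finset.card_univ, Fintype.card_fin,
    nsmul_eq_mul] at h
  rw [← ENNReal.ofReal_toReal (measure_ne_top μ _)]
  refine ENNReal.ofReal_le_ofReal ?_
  rw [le_div_iff₀ hK]
  -- Threshold and expectation are both linear in `d`, which therefore cancels.
  have h' : K * (μ {ω | K * d ≤ ∑ i, ‖e i ω‖ ^ 2}).toReal * d ≤ n * ν * d := by
    rw [Measure.real] at h
    linarith
  linarith [le_of_mul_le_mul_right h' hd']

end Noise

theorem mainTheorem5 (F : Type*) [Field F] {n s : ℕ} (hn : 3 < n) (hs : s < n)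
    (a : Fin n → Fin s → ℝ) {ν : ℝ} (hν : 0 < ν)
    {Ω : ℕ → Type*} [∀ d, MeasurableSpace (Ω d)]
    (μ : ∀ d, Measure (Ω d)) [∀ d, IsProbabilityMeasure (μ d)]
    (P : ∀ d : ℕ, Fin n → EuclideanSpace ℝ (Fin d))
    (hP : ∀ d i, P d i = zeroPad d (a i))
    (e : ∀ d : ℕ, Fin n → Ω d → EuclideanSpace ℝ (Fin d))
    (he : ∀ d, n < d → IsNoiseCloud (μ d) ν (e d))
    (P' : ∀ d : ℕ, Ω d → Fin n → EuclideanSpace ℝ (Fin d))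
    (hP' : ∀ d ω i, P' d ω i = P d i + e d i ω)
    (N : ℕ) (hN : N ≤ n - 2) :
    (∀ d, n < d → ∀ ω, bottleneckDist (withDiagonal (cechDiagram F N (P d)))
      (withDiagonal (cechDiagram F N (P' d ω))) ≠ ⊤) ∧
    IsBigOInProb μ
      (fun d ω => (bottleneckDist (withDiagonal (cechDiagram F N (P d)))
        (withDiagonal (cechDiagram F N (P' d ω)))).toReal)
      (fun d _ => √(d : ℝ)) := by
  -- A pathwise bound with `K` free, used for both claims. The `+ 1` keeps the radius positive even
  -- if all points vanish.
  have hradius : ∀ d, 0 < d → ∀ ω, ∀ K : ℝ, 0 ≤ K → ∑ i, ‖e d i ω‖ ^ 2 ≤ K * d →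
      bottleneckDist (withDiagonal (cechDiagram F N (P d)))
        (withDiagonal (cechDiagram F N (P' d ω))) ≤
      ENNReal.ofReal (√d * ((∑ i, ∑ j, |a i j|) + √K + 1)) := by
    intro d hd ω K hK hS
    have hd' : 0 < √(d : ℝ) := Real.sqrt_pos.2 (Nat.cast_pos.2 hd)
    have hA : 0 ≤ ∑ i, ∑ j, |a i j| :=
      Finset.sum_nonneg fun _ _ => Finset.sum_nonneg fun _ _ => abs_nonneg _
    have hx : ∀ i, ‖P d i‖ ≤ √d * ∑ i, ∑ j, |a i j| := fun i => by
      rw [hP]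
      refine (norm_zeroPad_le d (a i)).trans (mul_le_mul_of_nonneg_left ?_ hd'.le)
      exact Finset.single_le_sum (f := fun i => ∑ j, |a i j|)
        (fun _ _ => Finset.sum_nonneg fun _ _ => abs_nonneg _) (Finset.mem_univ i)
    have hnoise : ∀ i, ‖e d i ω‖ ≤ √d * √K := fun i => by
      rw [mul_comm, ← Real.sqrt_mul hK]
      exact Real.le_sqrt_of_sq_le ((Finset.single_le_sum (f := fun i => ‖e d i ω‖ ^ 2)
        (fun _ _ => sq_nonneg _) (Finset.mem_univ i)).trans hS)
    have hK' : 0 ≤ √d * √K := by positivity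
    refine bottleneckDist_cechDiagram_le F N (c := 0) (by positivity) (fun i => ?_) (fun i => ?_)
    · rw [dist_zero_left]
      linarith [hx i]
    · rw [dist_zero_left, hP']
      linarith [norm_add_le (P d i) (e d i ω), hx i, hnoise i]
  refine ⟨fun d hd ω => ?_, ?_⟩
  · have hd' : (0 : ℝ) < d := Nat.cast_pos.2 (by omega)
    -- For finiteness `K` may depend on `ω`.
    refine ne_top_of_le_ne_top ENNReal.ofReal_ne_top
      (hradius d (by omega) ω ((∑ i, ‖e d i ω‖ ^ 2) / d) (by positivity) ?_)
    rw [div_mul_cancel₀ _ hd'.ne']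
  refine ⟨fun d ω => (bottleneckDist (withDiagonal (cechDiagram F N (P d)))
        (withDiagonal (cechDiagram F N (P' d ω)))).toReal / √d, ?_, ?_⟩
  · intro ε hε
    have hn' : (0 : ℝ) < n := Nat.cast_pos.2 (by omega)
    -- With `K = n ν / ε` the Markov bound `n ν / K` is exactly `ε`.
    have hK : 0 < n * ν / ε := by positivity
    refine ⟨(∑ i, ∑ j, |a i j|) + √(n * ν / ε) + 1, n, fun d hd => ?_⟩
    have hmarkov := (he d hd).measure_le_div (by omega) hK
    rw [div_div_cancel₀ (by positivity)] at hmarkov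
    refine (measure_mono fun ω hω => ?_).trans hmarkov
    simp only [Set.mem_ofPred_eq] at hω ⊢
    by_contra! hS
    refine hω ?_
    have hd' : 0 < √(d : ℝ) := Real.sqrt_pos.2 (Nat.cast_pos.2 (by omega))
    rw [abs_of_nonneg (by positivity), div_le_iff₀ hd', mul_comm]
    refine ENNReal.toReal_le_of_le_ofReal ?_ (hradius d (by omega) ω _ hK.le hS.le)
    have : 0 ≤ ∑ i, ∑ j, |a i j| :=
      Finset.sum_nonneg fun _ _ => Finset.sum_nonneg fun _ _ => abs_nonneg _
    positivity
  · filter_upwards [eventually_gt_atTop 0] with d hd ω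
    have hd' : 0 < √(d : ℝ) := Real.sqrt_pos.2 (Nat.cast_pos.2 hd)
    rw [mul_div_cancel₀ _ hd'.ne']
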